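/- Simple types are generated from a set of type variables by $\omega\to\omega'$. An interaction system on a set $S$ of states consists of a set $A(s)$ of actions for each $s\in S$, a set $D(s,a)$ of reactions for each $a\in A(s)$, and a new state $s[a/d]\in S$ for each $d\in D(s,a)$. Fix a valuation $\rho$ sending each type variable to an interaction system; a type $\omega$ is then interpreted by the interaction system $\omega^*$ with $X^*=\rho(X)$ and $(\omega\to\omega')^*={!\omega^*}\multimap\omega'^*$, where $!$ is the synchronous multithreading modulo permutations and $\multimap$ the linear arrow. Let $|\omega|$ be the set of states of $\omega^*$, so that $|X|$ is the set of states of $\rho(X)$ and $|\omega\to\omega'|=\mathcal M_f(|\omega|)\times|\omega'|$, where $\mathcal M_f(S)$ is the set of finite multisets over $S$. Typed differential $\lambda$-terms (up to renaming of bound variables) are given by the rules: $\Gamma\vdash x:\omega$ if $x:\omega$ is in $\Gamma$; $\Gamma\vdash (t)u:\omega'$ if $\Gamma\vdash t:\omega\to\omega'$ and $\Gamma\vdash u:\omega$; $\Gamma\vdash\lambda x.t:\omega\to\omega'$ if $\Gamma,x:\omega\vdash t:\omega'$; $\Gamma\vdash 0:\omega$; $\Gamma\vdash t+u:\omega$ if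 $\Gamma\vdash t:\omega$ and $\Gamma\vdash u:\omega$; $\Gamma\vdash \mathrm D t\cdot u:\omega\to\omega'$ if $\Gamma\vdash t:\omega\to\omega'$ and $\Gamma\vdash u:\omega$. Write $t[u/x]$ for capture-avoiding substitution, and let the differential substitution $\frac{\partial t}{\partial x}\cdot u$ be defined by $\frac{\partial x}{\partial x}\cdot u=u$; $\frac{\partial y}{\partial x}\cdot u=0$ for a variable $y\ne x$; $\frac{\partial (t)v}{\partial x}\cdot u=\left(\frac{\partial t}{\partial x}\cdot u\right)v+\left(\mathrm D t\cdot\left(\frac{\partial v}{\partial x}\cdot u\right)\right)v$; $\frac{\partial \lambda y.t}{\partial x}\cdot u=\lambda y.\frac{\partial t}{\partial x}\cdot u$ ($y\neq x$ not free in $u$); $\frac{\partial 0}{\partial x}\cdot u=0$; $\frac{\partial (t+v)}{\partial x}\cdot u=\frac{\partial t}{\partial x}\cdot u+\frac{\partial v}{\partial x}\cdot u$; $\frac{\partial (\mathrm D t\cdot v)}{\partial x}\cdot u=\mathrm D\left(\frac{\partial t}{\partial x}\cdot u\right)\cdot v+\mathrm D t\cdot\left(\frac{\partial v}{\partial x}\cdot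 u\right)$. An environment $\gamma$ for $\Gamma$ assigns to each variable $x:\omega$ of $\Gamma$ a multiset $\gamma(x)\in\mathcal M_f(|\omega|)$; environments are added pointwise. For $\Gamma\vdash t:\omega$ and an environment $\gamma$ for $\Gamma$, the interpretation $[\![t]\!]_\gamma\subseteq|\omega|$ is defined by induction on the typing derivation: - $s\in[\![x]\!]_\gamma$ iff $\gamma(x)=[s]$ and $\gamma(y)=[\,]$ for every $y\neq x$; - $s\in[\![(t)u]\!]_\gamma$ iff there are $n\ge 0$, environments with $\gamma=\gamma_0+\gamma_1+\dots+\gamma_n$, and $s_i\in[\![u]\!]_{\gamma_i}$ ($1\le i\le n$) such that $([s_1,\dots,s_n],s)\in[\![t]\!]_{\gamma_0}$; - $[\![\lambda x.t]\!]_\gamma=\{(\mu,s)\mid s\in[\![t]\!]_{\gamma,x:=\mu}\}$; - $[\![0]\!]_\gamma=\emptyset$ and $[\![t+u]\!]_\gamma=[\![t]\!]_\gamma\cup[\![u]\!]_\gamma$; - $(\mu,s')\in[\![\mathrm D t\cdot u]\!]_\gamma$ iff there are $\gamma=\gamma_1+\gamma_2$ and $s\in[\![u]\!]_{\gamma_2}$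 with $(\mu+[s],s')\in[\![t]\!]_{\gamma_1}$. **Proposition.** For all valuations $\rho$, contexts $\Gamma$, types $\omega,\omega'$, differential terms $\Gamma,x:\omega\vdash t:\omega'$ and $\Gamma\vdash u:\omega$, and environments $\gamma$ for $\Gamma$, $$[\![(\lambda x.t)u]\!]_\gamma=[\![t[u/x]]\!]_\gamma\qquad\text{and}\qquad[\![\mathrm D(\lambda x.t)\cdot u]\!]_\gamma=\left[\!\left[\lambda x.\,\tfrac{\partial t}{\partial x}\cdot u\right]\!\right]_\gamma .$$ -/

import Mathlib

universe u v

namespace DiffLambda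

/-! ### Interaction systems and the interpretation of types -/

/-- An interaction system, bundled with its set of states: `next s a d` is `s[a/d]`. -/
structure InteractionSystem : Type (u + 1) where
  State : Type u
  Action : State → Type u
  Reaction : (s : State) → Action s → Type u
  next : (s : State) → (a : Action s) → Reaction s a → State

namespace InteractionSystem

/-- The linear arrow `w₁ ⊸ w₂`. -/
def lolli (w₁ w₂ : InteractionSystem.{u}) : InteractionSystem.{u} where
  State := w₁.State × w₂.State
  Action s := Σ f : w₁.Action s.1 → w₂.Action s.2,
    (a₁ : w₁.Action s.1) → w₂.Reaction s.2 (f a₁) → w₁.Reaction s.1 a₁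
  Reaction s fG := Σ a₁ : w₁.Action s.1, w₂.Reaction s.2 (fG.1 a₁)
  next s fG d := (w₁.next s.1 d.1 (fG.2 d.1 d.2), w₂.next s.2 (fG.1 d.1) d.2)

/-- Actions of the multithreaded system: a tuple with one action for each state of the list. -/
def ListAction (w : InteractionSystem.{u}) : List w.State → Type u
  | [] => PUnit
  | s :: l => w.Action s × w.ListAction l

/-- Reactions of the multithreaded system: a tuple with one reaction for each action. -/
def ListReaction (w : InteractionSystem.{u}) : (l : List w.State) → w.ListAction l → Type u
  | [], _ => PUnit
  | s :: l, a => w.Reaction s a.1 × w.ListReaction l a.2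

/-- The next state of the multithreaded system, computed componentwise. -/
def listNext (w : InteractionSystem.{u}) :
    (l : List w.State) → (a : w.ListAction l) → w.ListReaction l a → List w.State
  | [], _, _ => []
  | s :: l, a, d => w.next s a.1 d.1 :: w.listNext l a.2 d.2

/-- `!w`: multithreading modulo permutations, on finite multisets of states. An action in state
`μ` is a list representing `μ` together with a tuple of actions for that list. -/
def bang (w : InteractionSystem.{u}) : InteractionSystem.{u} where
  State := Multiset w.State
  Action μ := Σ l : {l : List w.State // (l : Multiset w.State) = μ}, w.ListAction l.1
  Reaction _ a := w.ListReaction a.1.1 a.2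
  next _ a d := (w.listNext a.1.1 a.2 d : Multiset w.State)

end InteractionSystem

/-- Simple types over a set `X` of type variables. -/
inductive Ty (X : Type v) : Type v where
  | var : X → Ty X
  | arrow : Ty X → Ty X → Ty X

/-- The interaction system interpreting a type, for a valuation `ρ` of the type variables:
`(ω → ω')^* = !ω^* ⊸ ω'^*`. -/
def Ty.interp {X : Type v} (ρ : X → InteractionSystem.{u}) : Ty X → InteractionSystem.{u}
  | .var i => ρ i
  | .arrow ω ω' => (ω.interp ρ).bang.lolli (ω'.interp ρ)

/-- `|ω|`, the set of states of the interpretation of `ω`. -/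
abbrev Ty.States {X : Type v} (ρ : X → InteractionSystem.{u}) (ω : Ty X) : Type u :=
  (ω.interp ρ).State

/-- `|ω → ω'|` consists of the pairs of a finite multiset over `|ω|` and an element of `|ω'|`. -/
theorem Ty.states_arrow {X : Type v} (ρ : X → InteractionSystem.{u}) (ω ω' : Ty X) :
    (Ty.arrow ω ω').States ρ = (Multiset (ω.States ρ) × ω'.States ρ) := rfl

/-! ### Typed differential terms

Terms are taken up to renaming of bound variables, so they are represented by their typing
derivations with de Bruijn variables. A context is a list of types; its head is the type of the
variable introduced last, i.e. the context `Γ, x : ω` is `ω :: Γ`. -/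

/-- `Var Γ ω`: the variables of type `ω` in the context `Γ`. -/
inductive Var {X : Type v} : List (Ty X) → Ty X → Type v where
  | zero {Γ : List (Ty X)} {ω : Ty X} : Var (ω :: Γ) ω
  | succ {Γ : List (Ty X)} {ω τ : Ty X} : Var Γ ω → Var (τ :: Γ) ω

/-- `Term Γ ω`: the differential terms `t` with `Γ ⊢ t : ω`.
`app t u` is `(t)u`, and `diff t u` is `D t · u`. -/
inductive Term {X : Type v} : List (Ty X) → Ty X → Type v where
  | var {Γ : List (Ty X)} {ω : Ty X} : Var Γ ω → Term Γ ω
  | app {Γ : List (Ty X)} {ω ω' : Ty X} : Term Γ (.arrow ω ω') → Term Γ ω → Term Γ ω'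
  | lam {Γ : List (Ty X)} {ω ω' : Ty X} : Term (ω :: Γ) ω' → Term Γ (.arrow ω ω')
  | zero {Γ : List (Ty X)} {ω : Ty X} : Term Γ ω
  | add {Γ : List (Ty X)} {ω : Ty X} : Term Γ ω → Term Γ ω → Term Γ ω
  | diff {Γ : List (Ty X)} {ω ω' : Ty X} :
      Term Γ (.arrow ω ω') → Term Γ ω → Term Γ (.arrow ω ω')

section Substitution

variable {X : Type v}

/-- Extend a renaming of variables under a binder. -/
def Var.lift {Γ Δ : List (Ty X)} {σ : Ty X} (f : (τ : Ty X) → Var Γ τ → Var Δ τ) :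
    (τ : Ty X) → Var (σ :: Γ) τ → Var (σ :: Δ) τ
  | _, .zero => .zero
  | _, .succ x => .succ (f _ x)

/-- Renaming of the free variables of a term. -/
def Term.rename {Γ Δ : List (Ty X)} {ω : Ty X} (f : (τ : Ty X) → Var Γ τ → Var Δ τ) :
    Term Γ ω → Term Δ ω
  | .var x => .var (f _ x)
  | .app t u => .app (t.rename f) (u.rename f)
  | .lam t => .lam (t.rename (Var.lift f))
  | .zero => .zero
  | .add t u => .add (t.rename f) (u.rename f)
  | .diff t u => .diff (t.rename f) (u.rename f)

/-- A term in context `Γ`, seen in `Γ, x : σ` for a fresh variable `x`. -/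
def Term.weaken {Γ : List (Ty X)} {σ ω : Ty X} (t : Term Γ ω) : Term (σ :: Γ) ω :=
  t.rename (fun _ x => .succ x)

/-- Extend a simultaneous substitution under a binder. -/
def Term.liftSubst {Γ Δ : List (Ty X)} {σ : Ty X} (f : (τ : Ty X) → Var Γ τ → Term Δ τ) :
    (τ : Ty X) → Var (σ :: Γ) τ → Term (σ :: Δ) τ
  | _, .zero => .var .zero
  | _, .succ x => (f _ x).weaken

/-- Simultaneous capture-avoiding substitution. -/
def Term.subst {Γ Δ : List (Ty X)} {ω : Ty X} (f : (τ : Ty X) → Var Γ τ → Term Δ τ) :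
    Term Γ ω → Term Δ ω
  | .var x => f _ x
  | .app t u => .app (t.subst f) (u.subst f)
  | .lam t => .lam (t.subst (Term.liftSubst f))
  | .zero => .zero
  | .add t u => .add (t.subst f) (u.subst f)
  | .diff t u => .diff (t.subst f) (u.subst f)

/-- The substitution sending the variable introduced last to `u` and fixing all others. -/
def Term.single {Γ : List (Ty X)} {σ : Ty X} (u : Term Γ σ) :
    (τ : Ty X) → Var (σ :: Γ) τ → Term Γ τ
  | _, .zero => u
  | _, .succ x => .var x

/-- `t[u/x]`, where `x` is the variable of `t` introduced last. -/
def Term.instantiate {Γ : List (Ty X)} {σ ω : Ty X} (t : Term (σ :: Γ) ω) (u : Term Γ σ) :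
    Term Γ ω :=
  t.subst (Term.single u)

/-- `y.ifEq x a b` is `a` if `y` and `x` are the same variable (so that their types agree),
and `b` otherwise. -/
def Var.ifEq {C : Ty X → Type v} : {Γ : List (Ty X)} → {τ ω : Ty X} →
    Var Γ τ → Var Γ ω → C ω → C τ → C τ
  | _, _, _, .zero, .zero, a, _ => a
  | _, _, _, .zero, .succ _, _, b => b
  | _, _, _, .succ _, .zero, _, b => b
  | _, _, _, .succ y, .succ x, a, b => Var.ifEq y x a b

/-- `t.deriv x u` is the linear substitution `(∂t/∂x) · u` of Ehrhard and Regnier: the sum of the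
terms obtained by replacing exactly one (linear) occurrence of `x` in `t` by `u`. -/
def Term.deriv {Γ : List (Ty X)} {σ ω : Ty X} :
    Term Γ ω → Var Γ σ → Term Γ σ → Term Γ ω
  | .var y, x, u => y.ifEq x u .zero
  | .app t v, x, u =>
      .add (.app (t.deriv x u) v) (.app (.diff t (v.deriv x u)) v)
  | .lam t, x, u => .lam (t.deriv x.succ u.weaken)
  | .zero, _, _ => .zero
  | .add t v, x, u => .add (t.deriv x u) (v.deriv x u)
  | .diff t v, x, u =>
      .add (.diff (t.deriv x u) v) (.diff t (v.deriv x u))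

end Substitution

/-! ### The interpretation of terms -/

section Interpretation

variable {X : Type v} (ρ : X → InteractionSystem.{u})

/-- Environments for `Γ`: a finite multiset over `|ω|` for each variable of type `ω` of `Γ`.
Their sum is the pointwise sum of multisets. -/
abbrev Env (Γ : List (Ty X)) : Type (max u v) :=
  (ω : Ty X) → Var Γ ω → Multiset (ω.States ρ)

variable {ρ}

/-- The environment `γ, x := μ`. -/
def Env.extend {Γ : List (Ty X)} {σ : Ty X} (γ : Env ρ Γ) (μ : Multiset (σ.States ρ)) :
    Env ρ (σ :: Γ)
  | _, .zero => μ
  | _, .succ y => γ _ y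

/-- The interpretation `⟦t⟧_γ ⊆ |ω|` of a differential term `Γ ⊢ t : ω`.

In the case of an application `(t)u`, the family `(γ₁, s₁), …, (γₙ, sₙ)` with `sᵢ ∈ ⟦u⟧_γᵢ` is
given by the finite multiset `p` of these pairs. -/
def Term.sem : {Γ : List (Ty X)} → {ω : Ty X} → Term Γ ω → Env ρ Γ → Set (ω.States ρ)
  | Γ, ω, .var x, γ =>
      {s | γ ω x = {s} ∧ ∀ (τ : Ty X) (y : Var Γ τ),
        (⟨τ, y⟩ : Σ τ : Ty X, Var Γ τ) ≠ ⟨ω, x⟩ → γ τ y = 0}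
  | Γ, _, .app (ω := ω) t u, γ =>
      {s | ∃ (γ₀ : Env ρ Γ) (p : Multiset (Env ρ Γ × ω.States ρ)),
        (p.map Prod.snd, s) ∈ t.sem γ₀ ∧ (∀ q ∈ p, q.2 ∈ u.sem q.1) ∧
        γ = γ₀ + (p.map Prod.fst).sum}
  | _, _, .lam (ω := ω) (ω' := ω') t, γ =>
      {p : Multiset (ω.States ρ) × ω'.States ρ | p.2 ∈ t.sem (γ.extend p.1)}
  | _, _, .zero, _ => ∅
  | _, _, .add t u, γ => t.sem γ ∪ u.sem γ
  | Γ, _, .diff (ω := ω) (ω' := ω') t u, γ =>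
      {p : Multiset (ω.States ρ) × ω'.States ρ |
        ∃ (γ₁ γ₂ : Env ρ Γ) (s : ω.States ρ),
          (p.1 + {s}, p.2) ∈ t.sem γ₁ ∧ s ∈ u.sem γ₂ ∧ γ = γ₁ + γ₂}

end Interpretation

end DiffLambda

/-! Environments form a free commutative monoid whose generators `Env.single x a` are single
occurrences of a state `a` at a variable `x`. Both equations come from following these occurrences
through a term.

For substitution, `Transport F δ γ` says that `γ` arises from `δ` by replacing each occurrence of
`s` at `x` by some environment in which `s` belongs to the value at `x`. The substitution lemma
`isTransport_subst` states that the meaning of a substituted term at `γ` is the union of the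
meanings of `t` at all such `δ`. For the substitution of `u` for `x`, the occurrences at `x` become
a family of states of `u` and all others stay fixed (`transport_single_iff`). This is exactly the
clause for an application.

For differentiation, `mem_sem_deriv` shows that the syntactic derivative gives one occurrence of `x`
to `u`. In a sum of environments that occurrence can be assigned to one summand
(`Env.add_single_eq_add`), which is the Leibniz rule. At a bound variable this becomes the clause
for `D t · u`. -/

namespace DiffLambda

variable {X : Type v} {ρ : X → InteractionSystem.{u}} {Γ Δ : List (Ty X)} {σ τ ω ω' : Ty X}

/-! ### Environments -/

namespace Env

/-- The restriction of an environment for `Γ, x : σ` to `Γ`. -/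
def tail (γ : Env ρ (σ :: Γ)) : Env ρ Γ := fun _ x => γ _ x.succ

/-- The environment with value `[a]` at `x` and the empty multiset elsewhere. -/
def single : {Γ : List (Ty X)} → {σ : Ty X} → Var Γ σ → σ.States ρ → Env ρ Γ
  | _, _, .zero, a => Env.extend 0 {a}
  | _, _, .succ x, a => Env.extend (single x a) 0

@[simp] theorem tail_extend (γ : Env ρ Γ) (μ : Multiset (σ.States ρ)) :
    tail (γ.extend μ) = γ := rfl

@[simp] theorem extend_tail (γ : Env ρ (σ :: Γ)) : (tail γ).extend (γ σ .zero) = γ := by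
  funext τ x
  cases x <;> rfl

theorem extend_add (γ δ : Env ρ Γ) (μ ν : Multiset (σ.States ρ)) :
    (γ + δ).extend (μ + ν) = γ.extend μ + δ.extend ν := by
  funext τ x
  cases x <;> rfl

@[simp] theorem extend_zero_zero : (0 : Env ρ Γ).extend (0 : Multiset (σ.States ρ)) = 0 := by
  funext τ x
  cases x <;> rfl

theorem extend_inj {γ δ : Env ρ Γ} {μ ν : Multiset (σ.States ρ)} :
    γ.extend μ = δ.extend ν ↔ γ = δ ∧ μ = ν := by
  constructor
  · intro h
    exact ⟨congrArg tail h, congrFun (congrFun h σ) .zero⟩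
  · rintro ⟨rfl, rfl⟩
    rfl

theorem single_same (x : Var Γ σ) (a : σ.States ρ) : single x a σ x = {a} := by
  induction x with
  | zero => rfl
  | succ x ih => exact ih a

theorem single_of_ne (x : Var Γ σ) (a : σ.States ρ) (y : Var Γ τ)
    (h : (⟨τ, y⟩ : Σ τ : Ty X, Var Γ τ) ≠ ⟨σ, x⟩) : single x a τ y = 0 := by
  induction x with
  | zero =>
    cases y with
    | zero => exact absurd rfl h
    | succ y => rfl
  | succ x ih =>
    cases y with
    | zero => rfl
    | succ y =>
      refine ih a y fun e => h ?_
      cases e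
      rfl

theorem exists_eq_add_single (x : Var Γ σ) (a : σ.States ρ) (γ : Env ρ Γ) (h : a ∈ γ σ x) :
    ∃ δ, γ = δ + single x a := by
  induction x with
  | zero =>
    obtain ⟨μ, hμ⟩ := Multiset.exists_cons_of_mem h
    refine ⟨(tail γ).extend μ, ?_⟩
    rw [single, ← extend_add, add_zero, add_comm μ, Multiset.singleton_add, ← hμ, extend_tail]
  | succ x ih =>
    obtain ⟨δ, hδ⟩ := ih a (tail γ) h
    refine ⟨δ.extend (γ _ .zero), ?_⟩
    rw [single, ← extend_add, add_zero, ← hδ, extend_tail]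

theorem add_single_ne_zero (γ : Env ρ Γ) (x : Var Γ σ) (a : σ.States ρ) :
    γ + single x a ≠ 0 := by
  intro h
  have h' : γ σ x + single x a σ x = 0 := congrFun (congrFun h σ) x
  rw [single_same] at h'
  simp at h'

theorem add_eq_zero {γ δ : Env ρ Γ} (h : γ + δ = 0) : γ = 0 ∧ δ = 0 := by
  have key : ∀ τ x, γ τ x = 0 ∧ δ τ x = 0 := fun τ x => by
    have h' : γ τ x + δ τ x = 0 := congrFun (congrFun h τ) x
    simpa using h'
  exact ⟨funext fun τ => funext fun x => (key τ x).1, funext fun τ => funext fun x => (key τ x).2⟩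

/-- A single occurrence in a sum of two environments comes from one of the summands. -/
theorem add_single_eq_add {γ β δ : Env ρ Γ} {x : Var Γ σ} {a : σ.States ρ}
    (h : γ + single x a = β + δ) :
    (∃ β', β = β' + single x a ∧ γ = β' + δ) ∨ ∃ δ', δ = δ' + single x a ∧ γ = β + δ' := by
  have hm : a ∈ β σ x + δ σ x := by
    have h' : γ σ x + single x a σ x = β σ x + δ σ x := congrFun (congrFun h σ) x
    rw [← h', single_same]
    simp
  rcases Multiset.mem_add.1 hm with hm | hm
  · obtain ⟨β', rfl⟩ := exists_eq_add_single x a β hm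
    refine .inl ⟨β', rfl, add_right_cancel (b := single x a) ?_⟩
    rw [h, add_right_comm]
  · obtain ⟨δ', rfl⟩ := exists_eq_add_single x a δ hm
    refine .inr ⟨δ', rfl, add_right_cancel (b := single x a) ?_⟩
    rw [h, add_assoc]

theorem single_inj {x : Var Γ σ} {a : σ.States ρ} {y : Var Γ τ} {b : τ.States ρ}
    (h : single x a = single y b) :
    (⟨σ, x, a⟩ : Σ τ : Ty X, Var Γ τ × τ.States ρ) = ⟨τ, y, b⟩ := by
  by_cases e : (⟨σ, x⟩ : Σ τ : Ty X, Var Γ τ) = ⟨τ, y⟩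
  · cases e
    have h' := congrFun (congrFun h σ) x
    rw [single_same, single_same, Multiset.singleton_inj] at h'
    rw [h']
  · have h' := congrFun (congrFun h σ) x
    rw [single_same, single_of_ne _ _ _ e] at h'
    simp at h'

/-- Generators are indivisible. This settles the variable case both of transport and of differential
substitution. -/
theorem add_single_eq_single {γ : Env ρ Γ} {x : Var Γ σ} {a : σ.States ρ} {y : Var Γ τ}
    {b : τ.States ρ} (h : γ + single x a = single y b) :
    γ = 0 ∧ (⟨σ, x, a⟩ : Σ τ : Ty X, Var Γ τ × τ.States ρ) = ⟨τ, y, b⟩ := by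
  rcases add_single_eq_add ((zero_add _).trans h.symm) with ⟨β, -, hβ⟩ | ⟨δ, hδ, h0⟩
  · exact absurd hβ.symm (add_single_ne_zero _ _ _)
  · obtain ⟨rfl, rfl⟩ := add_eq_zero h0.symm
    rw [zero_add] at hδ
    exact ⟨rfl, single_inj hδ⟩

/-- Environments are finite sums of single occurrences. -/
theorem induction_single {P : Env ρ Γ → Prop} (zero : P 0)
    (add_single : ∀ γ (σ : Ty X) (x : Var Γ σ) (a : σ.States ρ), P γ → P (γ + single x a))
    (γ : Env ρ Γ) : P γ := by
  induction Γ with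
  | nil =>
    have : γ = 0 := by
      funext τ x
      cases x
    exact this ▸ zero
  | cons σ Γ ih =>
    -- The older variables are filled first, with nothing at the newest one, whose multiset is then
    -- built element by element.
    have h : ∀ δ : Env ρ Γ, P (δ.extend 0) := by
      refine ih (P := fun δ => P (δ.extend 0)) (by simpa using zero) fun δ τ x a hδ => ?_
      have := add_single _ _ x.succ a hδ
      rwa [single, ← extend_add, add_zero] at this
    have h' : ∀ (δ : Env ρ Γ) μ, P (δ.extend μ) := by
      intro δ μ
      induction μ using Multiset.induction with
      | empty => exact h δ
      | cons a μ ihμ =>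
        have := add_single _ _ .zero a ihμ
        rwa [single, ← extend_add, add_zero, add_comm μ, Multiset.singleton_add] at this
    simpa using h' (tail γ) (γ _ .zero)

end Env

/-! ### Families of states in the interpretation of an argument -/

/-- `Many U μ γ`: one can write `μ = [s₁, …, sₙ]` and `γ = γ₁ + ⋯ + γₙ` with `sᵢ ∈ U γᵢ`. -/
inductive Many {S : Type u} (U : Env ρ Γ → Set S) : Multiset S → Env ρ Γ → Prop
  | zero : Many U 0 0
  | cons {μ : Multiset S} {γ δ : Env ρ Γ} {s : S} :
      Many U μ γ → s ∈ U δ → Many U (μ + {s}) (γ + δ)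

/-- Links the multiset of pairs in the application clause of `Term.sem` to an inductive predicate,
so that families can be handled by rule induction. -/
theorem many_iff {S : Type u} {U : Env ρ Γ → Set S} {μ : Multiset S} {γ : Env ρ Γ} :
    Many U μ γ ↔ ∃ p : Multiset (Env ρ Γ × S),
      p.map Prod.snd = μ ∧ (∀ q ∈ p, q.2 ∈ U q.1) ∧ γ = (p.map Prod.fst).sum := by
  constructor
  · intro h
    induction h with
    | zero => exact ⟨0, by simp⟩
    | @cons μ γ δ s _ hs ih =>
      obtain ⟨p, rfl, hp, rfl⟩ := ih
      refine ⟨(δ, s) ::ₘ p, ?_, ?_, ?_⟩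
      · simp [add_comm]
      · intro q hq
        rcases Multiset.mem_cons.1 hq with rfl | hq
        · exact hs
        · exact hp q hq
      · simp [add_comm]
  · rintro ⟨p, rfl, hp, rfl⟩
    induction p using Multiset.induction with
    | empty => simpa using Many.zero
    | cons q p ih =>
      have := Many.cons (ih fun r hr => hp r (Multiset.mem_cons_of_mem hr))
        (hp q (Multiset.mem_cons_self q p))
      simpa [add_comm] using this

/-- Removing one occurrence from the environment of a family affects exactly one member. -/
theorem Many.of_add_single {S : Type u} {U : Env ρ Γ → Set S} {μ : Multiset S} {γ : Env ρ Γ}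
    {x : Var Γ σ} {a : σ.States ρ} (h : Many U μ (γ + Env.single x a)) :
    ∃ μ' s γ₁ γ₂, μ = μ' + {s} ∧ γ = γ₁ + γ₂ ∧ Many U μ' γ₁ ∧ s ∈ U (γ₂ + Env.single x a) := by
  generalize hβ : γ + Env.single x a = β at h
  induction h generalizing γ with
  | zero => exact absurd hβ (Env.add_single_ne_zero _ _ _)
  | @cons μ β δ s hM hs ih =>
    -- The occurrence lies either among the earlier members or in the last one.
    rcases Env.add_single_eq_add hβ with ⟨β', h1, rfl⟩ | ⟨δ', rfl, rfl⟩
    · obtain ⟨μ', s', γ₁, γ₂, rfl, rfl, h2, h3⟩ := ih h1.symm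
      exact ⟨μ' + {s}, s', γ₁ + δ, γ₂, add_right_comm _ _ _, add_right_comm _ _ _,
        h2.cons hs, h3⟩
    · exact ⟨μ, s, β, δ', rfl, rfl, hM, hs⟩

/-! ### The interpretation of each term constructor -/

/-- The state `(μ, s)` of `ω → ω'`. -/
def Ty.pair (μ : Multiset (ω.States ρ)) (s : ω'.States ρ) : (Ty.arrow ω ω').States ρ := (μ, s)

theorem Ty.exists_eq_pair (s : (Ty.arrow ω ω').States ρ) :
    ∃ (μ : Multiset (ω.States ρ)) (s' : ω'.States ρ), s = Ty.pair μ s' := ⟨s.1, s.2, rfl⟩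

theorem Term.mem_sem_var {x : Var Γ ω} {γ : Env ρ Γ} {s : ω.States ρ} :
    s ∈ (Term.var x).sem γ ↔ γ = Env.single x s := by
  constructor
  · rintro ⟨h, h'⟩
    funext τ y
    by_cases e : (⟨τ, y⟩ : Σ τ : Ty X, Var Γ τ) = ⟨ω, x⟩
    · cases e
      rw [h, Env.single_same]
    · rw [h' τ y e, Env.single_of_ne _ _ _ e]
  · rintro rfl
    exact ⟨Env.single_same x s, fun τ y e => Env.single_of_ne _ _ _ e⟩

theorem Term.mem_sem_app {t : Term Γ (.arrow ω ω')} {u : Term Γ ω} {γ : Env ρ Γ}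
    {s : ω'.States ρ} :
    s ∈ (Term.app t u).sem γ ↔ ∃ (γ₀ γ₁ : Env ρ Γ) (μ : Multiset (ω.States ρ)),
      Ty.pair μ s ∈ t.sem γ₀ ∧ Many u.sem μ γ₁ ∧ γ = γ₀ + γ₁ := by
  constructor
  · rintro ⟨γ₀, p, h1, h2, h3⟩
    exact ⟨γ₀, _, _, h1, many_iff.2 ⟨p, rfl, h2, rfl⟩, h3⟩
  · rintro ⟨γ₀, γ₁, μ, h1, h2, h3⟩
    obtain ⟨p, rfl, h4, rfl⟩ := many_iff.1 h2
    exact ⟨γ₀, p, h1, h4, h3⟩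

theorem Term.mem_sem_lam {t : Term (ω :: Γ) ω'} {γ : Env ρ Γ} {μ : Multiset (ω.States ρ)}
    {s : ω'.States ρ} : Ty.pair μ s ∈ (Term.lam t).sem γ ↔ s ∈ t.sem (γ.extend μ) := Iff.rfl

theorem Term.not_mem_sem_zero {γ : Env ρ Γ} {s : ω.States ρ} :
    ¬ s ∈ (Term.zero : Term Γ ω).sem γ := fun h => h

theorem Term.mem_sem_add {t u : Term Γ ω} {γ : Env ρ Γ} {s : ω.States ρ} :
    s ∈ (Term.add t u).sem γ ↔ s ∈ t.sem γ ∨ s ∈ u.sem γ := Iff.rfl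

theorem Term.mem_sem_diff {t : Term Γ (.arrow ω ω')} {u : Term Γ ω} {γ : Env ρ Γ}
    {μ : Multiset (ω.States ρ)} {s' : ω'.States ρ} :
    Ty.pair μ s' ∈ (Term.diff t u).sem γ ↔ ∃ (γ₁ γ₂ : Env ρ Γ) (s : ω.States ρ),
      Ty.pair (μ + {s}) s' ∈ t.sem γ₁ ∧ s ∈ u.sem γ₂ ∧ γ = γ₁ + γ₂ := Iff.rfl

/-! ### Transport of environments along a family of interpretations -/

/-- `Transport F δ γ`: the environment `γ` is a sum, over all occurrences of states `s` in `δ x`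
for variables `x`, of environments `γ'` with `s ∈ F x γ'`. -/
inductive Transport (F : (τ : Ty X) → Var Γ τ → Env ρ Δ → Set (τ.States ρ)) :
    Env ρ Γ → Env ρ Δ → Prop
  | zero : Transport F 0 0
  | add_single {δ : Env ρ Γ} {γ γ' : Env ρ Δ} {τ : Ty X} {x : Var Γ τ} {s : τ.States ρ} :
      Transport F δ γ → s ∈ F τ x γ' → Transport F (δ + Env.single x s) (γ + γ')

namespace Transport

variable {F : (τ : Ty X) → Var Γ τ → Env ρ Δ → Set (τ.States ρ)}

theorem add {δ₁ δ₂ : Env ρ Γ} {γ₁ γ₂ : Env ρ Δ} (h₁ : Transport F δ₁ γ₁)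
    (h₂ : Transport F δ₂ γ₂) : Transport F (δ₁ + δ₂) (γ₁ + γ₂) := by
  induction h₂ with
  | zero => simpa using h₁
  | add_single _ hs ih =>
    rw [← add_assoc, ← add_assoc]
    exact ih.add_single hs

theorem of_zero {γ : Env ρ Δ} (h : Transport F 0 γ) : γ = 0 := by
  generalize hδ : (0 : Env ρ Γ) = δ at h
  cases h with
  | zero => rfl
  | add_single => exact absurd hδ.symm (Env.add_single_ne_zero _ _ _)

/-- Each transported occurrence can be assigned to one of the two summands, and its image follows
it. With `add`, this makes transport compatible with the sums in the application and differential
clauses. -/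
theorem split {δ₁ δ₂ : Env ρ Γ} {γ : Env ρ Δ} (h : Transport F (δ₁ + δ₂) γ) :
    ∃ γ₁ γ₂, γ = γ₁ + γ₂ ∧ Transport F δ₁ γ₁ ∧ Transport F δ₂ γ₂ := by
  generalize hδ : δ₁ + δ₂ = δ at h
  induction h generalizing δ₁ δ₂ with
  | zero =>
    obtain ⟨rfl, rfl⟩ := Env.add_eq_zero hδ
    exact ⟨0, 0, by simp, .zero, .zero⟩
  | add_single _ hs ih =>
    rcases Env.add_single_eq_add hδ.symm with ⟨β, rfl, h1⟩ | ⟨β, rfl, h1⟩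
    · obtain ⟨γ₁, γ₂, rfl, h2, h3⟩ := ih h1.symm
      exact ⟨_, γ₂, add_right_comm _ _ _, h2.add_single hs, h3⟩
    · obtain ⟨γ₁, γ₂, rfl, h2, h3⟩ := ih h1.symm
      exact ⟨γ₁, _, add_assoc _ _ _, h2, h3.add_single hs⟩

theorem single_iff {x : Var Γ τ} {s : τ.States ρ} {γ : Env ρ Δ} :
    Transport F (Env.single x s) γ ↔ s ∈ F τ x γ := by
  constructor
  · intro h
    generalize hδ : Env.single x s = δ at h
    cases h with
    | zero => exact absurd ((zero_add _).trans hδ) (Env.add_single_ne_zero 0 _ _)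
    | add_single h hs =>
      obtain ⟨rfl, e⟩ := Env.add_single_eq_single hδ.symm
      cases e
      rwa [h.of_zero, zero_add]
  · intro h
    simpa using Transport.zero.add_single h

/-- Transport under a binder keeps the value of the bound variable. -/
theorem extend_iff {F' : (τ : Ty X) → Var (σ :: Γ) τ → Env ρ (σ :: Δ) → Set (τ.States ρ)}
    (hzero : ∀ γ s, s ∈ F' σ .zero γ ↔ γ = Env.single .zero s)
    (hsucc : ∀ τ (x : Var Γ τ) γ s,
      s ∈ F' τ x.succ γ ↔ ∃ γ', γ = Env.extend γ' 0 ∧ s ∈ F τ x γ')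
    {δ : Env ρ (σ :: Γ)} {γ : Env ρ Δ} {μ : Multiset (σ.States ρ)} :
    Transport F' δ (γ.extend μ) ↔ ∃ δ', δ = Env.extend δ' μ ∧ Transport F δ' γ := by
  constructor
  · intro h
    -- The target is freed from the form `γ.extend μ`, so that induction on the transport applies.
    suffices H : ∀ β, Transport F' δ β →
        ∃ δ', δ = Env.extend δ' (β σ .zero) ∧ Transport F δ' (Env.tail β) from H _ h
    clear h
    intro β hβ
    induction hβ with
    | zero => exact ⟨0, by simp, .zero⟩
    | @add_single δ γ γ' τ x s _ hs ih =>
      obtain ⟨δ', rfl, hδ'⟩ := ih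
      cases x with
      | zero =>
        rw [hzero] at hs
        subst hs
        refine ⟨δ', ?_, ?_⟩
        · rw [Env.single, ← Env.extend_add, add_zero]
          rfl
        · have : Env.tail (γ + Env.single .zero s) = Env.tail γ := by
            conv_lhs => rw [← Env.extend_tail γ, Env.single, ← Env.extend_add, add_zero,
              Env.tail_extend]
          rwa [this]
      | succ x =>
        obtain ⟨γ', rfl, hs'⟩ := (hsucc _ _ _ _).1 hs
        refine ⟨_, ?_, hδ'.add_single hs'⟩
        rw [Env.single, ← Env.extend_add]
        rfl
  · rintro ⟨δ', rfl, h⟩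
    -- The free variables are transported with the bound one empty; the elements of `μ` are then
    -- added one by one, each transported to itself.
    have h0 : Transport F' (δ'.extend 0) (γ.extend 0) := by
      induction h with
      | zero => simpa using Transport.zero
      | add_single _ hs ih =>
        have := ih.add_single ((hsucc _ _ _ _).2 ⟨_, rfl, hs⟩)
        rwa [Env.single, ← Env.extend_add, ← Env.extend_add, add_zero] at this
    induction μ using Multiset.induction with
    | empty => exact h0
    | cons a μ ih =>
      have := ih.add_single ((hzero _ a).2 rfl)
      simp only [Env.single, ← Env.extend_add, add_zero] at this
      rwa [add_comm μ, Multiset.singleton_add] at this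

end Transport

theorem many_transport_iff {F : (τ : Ty X) → Var Γ τ → Env ρ Δ → Set (τ.States ρ)} {S : Type u}
    {U : Env ρ Γ → Set S} {U' : Env ρ Δ → Set S}
    (hU : ∀ γ s, s ∈ U' γ ↔ ∃ δ, Transport F δ γ ∧ s ∈ U δ)
    {μ : Multiset S} {γ : Env ρ Δ} :
    Many U' μ γ ↔ ∃ δ, Transport F δ γ ∧ Many U μ δ := by
  constructor
  · intro h
    induction h with
    | zero => exact ⟨0, .zero, .zero⟩
    | cons _ hs ih =>
      obtain ⟨δ, h1, h2⟩ := ih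
      obtain ⟨δ', h3, h4⟩ := (hU _ _).1 hs
      exact ⟨_, h1.add h3, h2.cons h4⟩
  · rintro ⟨δ, h1, h2⟩
    induction h2 generalizing γ with
    | zero =>
      rw [h1.of_zero]
      exact .zero
    | cons _ hs ih =>
      obtain ⟨γ₁, γ₂, rfl, h3, h4⟩ := h1.split
      exact (ih h3).cons ((hU _ _).2 ⟨_, h4, hs⟩)

namespace Term

section Transport

variable {F : (τ : Ty X) → Var Γ τ → Env ρ Δ → Set (τ.States ρ)}

/-- The interpretation of `t'` is that of `t`, transported along `F`. -/
def IsTransport (F : (τ : Ty X) → Var Γ τ → Env ρ Δ → Set (τ.States ρ)) (t : Term Γ ω)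
    (t' : Term Δ ω) : Prop :=
  ∀ (γ : Env ρ Δ) (s : ω.States ρ), s ∈ t'.sem γ ↔ ∃ δ, Transport F δ γ ∧ s ∈ t.sem δ

theorem IsTransport.var {x : Var Γ ω} {t' : Term Δ ω} (h : ∀ γ, t'.sem γ = F ω x γ) :
    IsTransport F (.var x) t' := by
  intro γ s
  rw [h, ← Transport.single_iff (F := F)]
  simp only [mem_sem_var, exists_eq_right]

theorem IsTransport.app {t : Term Γ (.arrow ω ω')} {u : Term Γ ω} {t' : Term Δ (.arrow ω ω')}
    {u' : Term Δ ω} (ht : IsTransport F t t') (hu : IsTransport F u u') :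
    IsTransport F (.app t u) (.app t' u') := by
  intro γ s
  simp only [mem_sem_app]
  constructor
  · rintro ⟨γ₀, γ₁, μ, h1, h2, rfl⟩
    obtain ⟨δ₀, h3, h4⟩ := (ht _ _).1 h1
    obtain ⟨δ₁, h5, h6⟩ := (many_transport_iff hu).1 h2
    exact ⟨_, h3.add h5, δ₀, δ₁, μ, h4, h6, rfl⟩
  · rintro ⟨_, h, δ₀, δ₁, μ, h1, h2, rfl⟩
    obtain ⟨γ₀, γ₁, rfl, h3, h4⟩ := h.split
    exact ⟨γ₀, γ₁, μ, (ht _ _).2 ⟨_, h3, h1⟩, (many_transport_iff hu).2 ⟨_, h4, h2⟩, rfl⟩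

theorem IsTransport.diff {t : Term Γ (.arrow ω ω')} {u : Term Γ ω} {t' : Term Δ (.arrow ω ω')}
    {u' : Term Δ ω} (ht : IsTransport F t t') (hu : IsTransport F u u') :
    IsTransport F (.diff t u) (.diff t' u') := by
  intro γ s
  obtain ⟨μ, s, rfl⟩ := Ty.exists_eq_pair s
  simp only [mem_sem_diff]
  constructor
  · rintro ⟨γ₀, γ₁, a, h1, h2, rfl⟩
    obtain ⟨δ₀, h3, h4⟩ := (ht _ _).1 h1
    obtain ⟨δ₁, h5, h6⟩ := (hu _ _).1 h2
    exact ⟨_, h3.add h5, δ₀, δ₁, a, h4, h6, rfl⟩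
  · rintro ⟨_, h, δ₀, δ₁, a, h1, h2, rfl⟩
    obtain ⟨γ₀, γ₁, rfl, h3, h4⟩ := h.split
    exact ⟨γ₀, γ₁, a, (ht _ _).2 ⟨_, h3, h1⟩, (hu _ _).2 ⟨_, h4, h2⟩, rfl⟩

theorem IsTransport.zero : IsTransport F (.zero : Term Γ ω) .zero := fun _ _ =>
  ⟨fun h => absurd h not_mem_sem_zero, fun ⟨_, _, h⟩ => absurd h not_mem_sem_zero⟩

theorem IsTransport.add {t u : Term Γ ω} {t' u' : Term Δ ω} (ht : IsTransport F t t')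
    (hu : IsTransport F u u') : IsTransport F (.add t u) (.add t' u') := by
  intro γ s
  simp only [mem_sem_add, ht γ s, hu γ s, and_or_left, exists_or]

/-- The hypotheses describe a family lifted under a binder: the new variable goes to itself, and the
images of the old ones do not use it. -/
theorem IsTransport.lam
    {F' : (τ : Ty X) → Var (σ :: Γ) τ → Env ρ (σ :: Δ) → Set (τ.States ρ)}
    (hzero : ∀ γ s, s ∈ F' σ .zero γ ↔ γ = Env.single .zero s)
    (hsucc : ∀ τ (x : Var Γ τ) γ s,
      s ∈ F' τ x.succ γ ↔ ∃ γ', γ = Env.extend γ' 0 ∧ s ∈ F τ x γ')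
    {t : Term (σ :: Γ) ω} {t' : Term (σ :: Δ) ω} (ht : IsTransport F' t t') :
    IsTransport F (.lam t) (.lam t') := by
  intro γ s
  obtain ⟨μ, s, rfl⟩ := Ty.exists_eq_pair s
  simp only [mem_sem_lam, ht _ s, Transport.extend_iff hzero hsucc]
  constructor
  · rintro ⟨_, ⟨δ, rfl, h⟩, hs⟩
    exact ⟨δ, h, hs⟩
  · rintro ⟨δ, h, hs⟩
    exact ⟨_, ⟨δ, rfl, h⟩, hs⟩

end Transport

/-! ### Renaming and substitution -/

/-- Needed before the substitution lemma, because lifting a substitution under a binder weakens its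
terms and weakening is a renaming. -/
theorem isTransport_rename (f : (τ : Ty X) → Var Γ τ → Var Δ τ) (t : Term Γ ω) :
    IsTransport (ρ := ρ) (fun τ x => (Term.var (f τ x)).sem) t (t.rename f) := by
  induction t generalizing Δ with
  | var x => exact .var fun _ => rfl
  | app t u iht ihu => exact .app (iht f) (ihu f)
  | lam t ih =>
    refine .lam (fun γ s => mem_sem_var) (fun τ x γ s => ?_) (ih (Var.lift f))
    simp only [mem_sem_var, exists_eq_right]
    rfl
  | zero => exact .zero
  | add t u iht ihu => exact .add (iht f) (ihu f)
  | diff t u iht ihu => exact .diff (iht f) (ihu f)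

theorem mem_sem_weaken {t : Term Γ ω} {γ : Env ρ (σ :: Γ)} {s : ω.States ρ} :
    s ∈ t.weaken.sem γ ↔ ∃ γ', γ = Env.extend γ' 0 ∧ s ∈ t.sem γ' := by
  -- Along the successor renaming, transport is the graph of `δ ↦ δ.extend 0`.
  have key : ∀ δ : Env ρ Γ, Transport (fun τ (x : Var Γ τ) =>
      (Term.var (Var.succ (τ := σ) x)).sem (ρ := ρ)) δ γ ↔ γ = δ.extend 0 := by
    refine fun δ => ⟨fun h => ?_, ?_⟩
    · induction h with
      | zero => simp
      | add_single _ hs ih =>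
        rw [mem_sem_var] at hs
        rw [ih, hs, Env.single, ← Env.extend_add, add_zero]
    · rintro rfl
      induction δ using Env.induction_single with
      | zero => simpa using Transport.zero
      | add_single δ τ x a ih =>
        have := ih.add_single (mem_sem_var.2 (Eq.refl (Env.single x.succ a)))
        rwa [Env.single, ← Env.extend_add, add_zero] at this
  rw [weaken, isTransport_rename (fun _ x => Var.succ x) t γ s]
  simp only [key]

theorem isTransport_subst (f : (τ : Ty X) → Var Γ τ → Term Δ τ) (t : Term Γ ω) :
    IsTransport (ρ := ρ) (fun τ x => (f τ x).sem) t (t.subst f) := by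
  induction t generalizing Δ with
  | var x => exact .var fun _ => rfl
  | app t u iht ihu => exact .app (iht f) (ihu f)
  | lam t ih =>
    exact .lam (fun γ s => mem_sem_var) (fun τ x γ s => mem_sem_weaken) (ih (liftSubst f))
  | zero => exact .zero
  | add t u iht ihu => exact .add (iht f) (ihu f)
  | diff t u iht ihu => exact .diff (iht f) (ihu f)

/-- Each occurrence in `μ` is traded for an environment of `u`, which builds the family `Many`. An
occurrence at any other variable is sent to itself, so these contribute `δ` unchanged. -/
theorem transport_single_iff {u : Term Γ σ} {δ γ : Env ρ Γ} {μ : Multiset (σ.States ρ)} :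
    Transport (fun τ x => (Term.single u τ x).sem) (δ.extend μ) γ ↔
      ∃ γ', Many u.sem μ γ' ∧ γ = δ + γ' := by
  constructor
  · intro h
    suffices H : ∀ β, Transport (fun τ x => (Term.single u τ x).sem) β γ →
        ∃ γ', Many u.sem (β σ .zero) γ' ∧ γ = Env.tail β + γ' from H _ h
    clear h
    intro β hβ
    induction hβ with
    | zero => exact ⟨0, .zero, by simp; rfl⟩
    | @add_single δ γ γ' τ x s _ hs ih =>
      obtain ⟨β, hβ, rfl⟩ := ih
      cases x with
      | zero =>
        refine ⟨_, hβ.cons hs, ?_⟩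
        rw [← add_assoc]
        congr 2
        funext τ y
        exact (add_zero (δ τ y.succ)).symm
      | succ x =>
        refine ⟨β, ?_, ?_⟩
        · convert hβ using 1
          exact add_zero _
        · rw [mem_sem_var.1 hs, add_right_comm]
          rfl
  · rintro ⟨γ', h, rfl⟩
    induction h with
    | zero =>
      induction δ using Env.induction_single with
      | zero => simpa using Transport.zero
      | add_single δ τ x a ih =>
        rw [add_zero] at ih ⊢
        have := ih.add_single (x := x.succ) (mem_sem_var.2 (Eq.refl (Env.single x a)))
        rwa [Env.single, ← Env.extend_add, add_zero] at this
    | cons _ hs ih =>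
      have := ih.add_single (x := .zero) hs
      rwa [Env.single, ← Env.extend_add, add_zero, add_assoc] at this

theorem sem_app_lam (t : Term (ω :: Γ) ω') (u : Term Γ ω) (γ : Env ρ Γ) :
    (Term.app (.lam t) u).sem γ = (t.instantiate u).sem γ := by
  ext s
  rw [instantiate, isTransport_subst (Term.single u) t γ s, mem_sem_app]
  constructor
  · rintro ⟨γ₀, γ₁, μ, h1, h2, rfl⟩
    exact ⟨_, transport_single_iff.2 ⟨_, h2, rfl⟩, h1⟩
  · rintro ⟨δ, h, hs⟩
    rw [← Env.extend_tail δ] at h hs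
    obtain ⟨γ', h1, rfl⟩ := transport_single_iff.1 h
    exact ⟨_, _, _, hs, h1, rfl⟩

end Term

/-! ### Differential substitution -/

theorem Var.ifEq_self {C : Ty X → Type v} (x : Var Γ σ) (a b : C σ) : x.ifEq x a b = a := by
  induction x with
  | zero => rfl
  | succ x ih => exact ih a b

theorem Var.ifEq_of_ne {C : Ty X → Type v} (y : Var Γ τ) (x : Var Γ σ) (a : C σ) (b : C τ)
    (h : (⟨τ, y⟩ : Σ τ : Ty X, Var Γ τ) ≠ ⟨σ, x⟩) : y.ifEq x a b = b := by
  induction y with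
  | zero =>
    cases x with
    | zero => exact absurd rfl h
    | succ x => rfl
  | succ y ih =>
    cases x with
    | zero => rfl
    | succ x =>
      refine ih x b fun e => h ?_
      cases e
      rfl

namespace Term

/-- By induction on `t`: each clause of the derivative corresponds to a place where the
distinguished occurrence of `x` can go. In an application `(t)v` it goes to the function or to one
copy of the argument; the latter gives the summand containing `D t`. -/
theorem mem_sem_deriv {t : Term Γ ω} {x : Var Γ σ} {u : Term Γ σ} {γ : Env ρ Γ}
    {s : ω.States ρ} :
    s ∈ (t.deriv x u).sem γ ↔ ∃ (γ₁ γ₂ : Env ρ Γ) (a : σ.States ρ),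
      s ∈ t.sem (γ₁ + Env.single x a) ∧ a ∈ u.sem γ₂ ∧ γ = γ₁ + γ₂ := by
  induction t with
  | @var Γ ω y =>
    simp only [deriv, mem_sem_var]
    by_cases e : (⟨ω, y⟩ : Σ τ : Ty X, Var Γ τ) = ⟨σ, x⟩
    · cases e
      rw [Var.ifEq_self]
      constructor
      · intro h
        exact ⟨0, γ, s, zero_add _, h, (zero_add _).symm⟩
      · rintro ⟨γ₁, γ₂, a, h, ha, rfl⟩
        obtain ⟨rfl, e⟩ := Env.add_single_eq_single h
        cases e
        rwa [zero_add]
    · rw [Var.ifEq_of_ne _ _ _ _ e]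
      refine ⟨fun h => absurd h not_mem_sem_zero, ?_⟩
      rintro ⟨γ₁, γ₂, a, h, ha, rfl⟩
      obtain ⟨rfl, e'⟩ := Env.add_single_eq_single h
      cases e'
      exact absurd rfl e
  | app t v iht ihv =>
    simp only [deriv, mem_sem_add, mem_sem_app, mem_sem_diff, iht, ihv]
    constructor
    · rintro (⟨_, γ₁, μ, ⟨γ₂, γ₃, a, h1, h2, rfl⟩, h3, rfl⟩ |
        ⟨_, γ₁, μ, ⟨γ₂, _, b, h1, ⟨γ₃, γ₄, a, h2, h3, rfl⟩, rfl⟩, h4, rfl⟩)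
      · exact ⟨γ₂ + γ₁, γ₃, a, ⟨_, _, μ, h1, h3, add_right_comm _ _ _⟩, h2,
          add_right_comm _ _ _⟩
      -- The differentiated copy `b` of the argument rejoins the other copies.
      · refine ⟨γ₂ + γ₁ + γ₃, γ₄, a, ⟨_, _, _, h1, h4.cons h2, ?_⟩, h3, ?_⟩ <;> abel
    · rintro ⟨γ₁, γ₂, a, ⟨γ₃, γ₄, μ, h1, h2, h3⟩, ha, rfl⟩
      rcases Env.add_single_eq_add h3 with ⟨β, rfl, rfl⟩ | ⟨β, rfl, rfl⟩
      · exact .inl ⟨_, γ₄, μ, ⟨β, γ₂, a, h1, ha, rfl⟩, h2, add_right_comm _ _ _⟩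
      -- Conversely, the copy `b` that holds the occurrence is singled out as the linear argument of
      -- `D t`.
      · obtain ⟨μ', b, β₁, β₂, rfl, rfl, h4, h5⟩ := h2.of_add_single
        refine .inr ⟨_, β₁, μ', ⟨γ₃, _, b, h1, ⟨β₂, γ₂, a, h5, ha, rfl⟩, rfl⟩, h4, ?_⟩
        abel
  | lam t ih =>
    obtain ⟨μ, s, rfl⟩ := Ty.exists_eq_pair s
    simp only [deriv, mem_sem_lam, ih, mem_sem_weaken]
    constructor
    · rintro ⟨γ₁, _, a, h, ⟨γ₂, rfl, ha⟩, e⟩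
      rw [← Env.extend_tail γ₁] at h e
      -- The weakened `u` uses nothing at the bound variable, so all of `μ` lies in `γ₁`.
      rw [← Env.extend_add, Env.extend_inj, add_zero] at e
      obtain ⟨rfl, rfl⟩ := e
      rw [Env.single, ← Env.extend_add, add_zero] at h
      exact ⟨_, _, a, h, ha, rfl⟩
    · rintro ⟨γ₁, γ₂, a, h, ha, rfl⟩
      refine ⟨γ₁.extend μ, _, a, ?_, ⟨γ₂, rfl, ha⟩, ?_⟩
      · rwa [Env.single, ← Env.extend_add, add_zero]
      · rw [← Env.extend_add, add_zero]
  | zero =>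
    exact ⟨fun h => absurd h not_mem_sem_zero, fun ⟨_, _, _, h, _⟩ => absurd h not_mem_sem_zero⟩
  | add t v iht ihv =>
    simp only [deriv, mem_sem_add, iht, ihv, or_and_right, exists_or]
  | diff t v iht ihv =>
    obtain ⟨μ, s, rfl⟩ := Ty.exists_eq_pair s
    simp only [deriv, mem_sem_add, mem_sem_diff, iht, ihv]
    constructor
    · rintro (⟨_, γ₁, b, ⟨γ₂, γ₃, a, h1, h2, rfl⟩, h3, rfl⟩ |
        ⟨γ₁, _, b, h1, ⟨γ₂, γ₃, a, h2, h3, rfl⟩, rfl⟩)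
      · exact ⟨γ₂ + γ₁, γ₃, a, ⟨_, _, b, h1, h3, add_right_comm _ _ _⟩, h2,
          add_right_comm _ _ _⟩
      · exact ⟨γ₁ + γ₂, γ₃, a, ⟨_, _, b, h1, h2, add_assoc _ _ _⟩, h3, (add_assoc _ _ _).symm⟩
    · rintro ⟨γ₁, γ₂, a, ⟨γ₃, γ₄, b, h1, h2, h3⟩, ha, rfl⟩
      rcases Env.add_single_eq_add h3 with ⟨β, rfl, rfl⟩ | ⟨β, rfl, rfl⟩
      · exact .inl ⟨_, γ₄, b, ⟨β, γ₂, a, h1, ha, rfl⟩, h2, add_right_comm _ _ _⟩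
      · exact .inr ⟨γ₃, _, b, h1, ⟨β, γ₂, a, h2, ha, rfl⟩, add_assoc _ _ _⟩

/-- This is `mem_sem_deriv` at the bound variable: adding one occurrence there turns `μ` into `μ +
{a}`, the multiset in the differential clause. -/
theorem sem_diff_lam (t : Term (ω :: Γ) ω') (u : Term Γ ω) (γ : Env ρ Γ) :
    (Term.diff (.lam t) u).sem γ = (Term.lam (t.deriv .zero u.weaken)).sem γ := by
  ext s
  obtain ⟨μ, s, rfl⟩ := Ty.exists_eq_pair s
  simp only [mem_sem_diff, mem_sem_lam, mem_sem_deriv, mem_sem_weaken]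
  constructor
  · rintro ⟨γ₁, γ₂, a, h, ha, rfl⟩
    refine ⟨γ₁.extend μ, _, a, ?_, ⟨γ₂, rfl, ha⟩, ?_⟩
    · rwa [Env.single, ← Env.extend_add, add_zero]
    · rw [← Env.extend_add, add_zero]
  · rintro ⟨γ₁, _, a, h, ⟨γ₂, rfl, ha⟩, e⟩
    rw [← Env.extend_tail γ₁] at h e
    rw [← Env.extend_add, Env.extend_inj, add_zero] at e
    obtain ⟨rfl, rfl⟩ := e
    rw [Env.single, ← Env.extend_add, add_zero] at h
    exact ⟨_, _, a, h, ha, rfl⟩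

end Term

end DiffLambda

theorem mainTheorem6 {X : Type v} (ρ : X → DiffLambda.InteractionSystem.{u})
    {Γ : List (DiffLambda.Ty X)} {ω ω' : DiffLambda.Ty X}
    (t : DiffLambda.Term (ω :: Γ) ω') (u : DiffLambda.Term Γ ω) (γ : DiffLambda.Env ρ Γ) :
    (DiffLambda.Term.app (.lam t) u).sem γ = (t.instantiate u).sem γ ∧
    (DiffLambda.Term.diff (.lam t) u).sem γ =
      (DiffLambda.Term.lam (t.deriv .zero u.weaken)).sem γ :=
  ⟨DiffLambda.Term.sem_app_lam t u γ, DiffLambda.Term.sem_diff_lam t u γ⟩
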